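/- A kernel $d:\mathcal X\times\mathcal X\to\mathbb R$ is called \emph{restricted negative definite} if $\sum_{i,j=1}^m d(x_i,x_j)\,\xi_i\overline{\xi_j}\le 0$ for all $m$, all $x_1,\dots,x_m\in\mathcal X$ and all $\xi_1,\dots,\xi_m\in\mathbb C$ with $\sum_{i}\xi_i=0$. A kernel $K$ is called \emph{positive definite} if $\sum_{i,j=1}^m K(x_i,x_j)\,\xi_i\overline{\xi_j}\ge 0$ for all $m$, all $x_1,\dots,x_m\in\mathcal X$ and all $\xi_1,\dots,\xi_m\in\mathbb C$. Let $n\ge 3$, and let $d$ be a bi-invariant distance on $SO(n)$, that is, the Riemannian distance (infimum of lengths of curves) induced by a bi-invariant Riemannian metric on $SO(n)$, i.e. a Riemannian metric for which all left and right multiplications of the group are isometries. Then $d$ is not a restricted negative definite kernel. Consequently, for every $x_0\in SO(n)$, the Brownian kernel $$K(x,y)=\tfrac12\bigl(d(x,x_0)+d(y,x_0)-d(x,y)\bigr)$$ is not positive definite on $SO(n)$. This applies in particular to every bi-invariant Riemannian metric on $SO(4)$, where such a metric is not unique up to a scalar factor: there are two bi-invariant Riemannian metrics on $SO(4)$ that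 are not proportional. -/

import Mathlib

/-!
# Bi-invariant Riemannian distances on `SO(n)` and Brownian kernels

`SO(n)` is regarded as the usual embedded submanifold of the space of real `n × n` matrices.
-/

open scoped ContDiff

-- Entrywise sup norm on matrices; only the topology and the smooth structure that it induces are
-- used, and in finite dimension these do not depend on the norm.
attribute [local instance] Matrix.normedAddCommGroup Matrix.normedSpace

noncomputable section

namespace Brownian

/-! ### Kernels on a set -/

/-- `d` is a restricted negative definite kernel: `∑ d(x_i, x_j) ξ_i conj(ξ_j) ≤ 0` for all points
`x_i` and all complex numbers `ξ_i` with sum `0`. (For a symmetric real kernel, such as a distance,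
the sum is real, so that it coincides with its real part.) -/
def RestrictedNegDef {X : Type*} (d : X → X → ℝ) : Prop :=
  ∀ (m : ℕ) (x : Fin m → X) (ξ : Fin m → ℂ), ∑ i, ξ i = 0 →
    (∑ i, ∑ j, (d (x i) (x j) : ℂ) * ξ i * (starRingEnd ℂ) (ξ j)).re ≤ 0

/-- `K` is a positive definite kernel: `∑ K(x_i, x_j) ξ_i conj(ξ_j) ≥ 0` for all points `x_i` and
all complex numbers `ξ_i`. (Again the sum is real for a symmetric real kernel.) -/
def PosDefKernel {X : Type*} (K : X → X → ℝ) : Prop :=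
  ∀ (m : ℕ) (x : Fin m → X) (ξ : Fin m → ℂ),
    0 ≤ (∑ i, ∑ j, (K (x i) (x j) : ℂ) * ξ i * (starRingEnd ℂ) (ξ j)).re

/-- The Brownian kernel of `d` with base point `x₀`. -/
def brownianKernel {X : Type*} (d : X → X → ℝ) (x₀ x y : X) : ℝ :=
  (1 / 2) * (d x x₀ + d y x₀ - d x y)

/-! ### The manifold `SO(n)` -/

/-- The group `SO(n)`. -/
abbrev SO (n : ℕ) : Type := Matrix.specialOrthogonalGroup (Fin n) ℝ

variable {n : ℕ}

theorem SO.transpose_mul_self (g : SO n) :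
    (g : Matrix (Fin n) (Fin n) ℝ).transpose * (g : Matrix (Fin n) (Fin n) ℝ) = 1 :=
  (Matrix.mem_orthogonalGroup_iff' (Fin n) ℝ).1 (Matrix.mem_specialOrthogonalGroup_iff.1 g.2).1

/-- The tangent space `T_g SO(n)`, as a subspace of the space of matrices: the kernel of the
differential at `g` of the map `A ↦ Aᵀ A`. -/
def tangentSpace (g : SO n) : Submodule ℝ (Matrix (Fin n) (Fin n) ℝ) where
  carrier := {M | M.transpose * (g : Matrix (Fin n) (Fin n) ℝ)
    + (g : Matrix (Fin n) (Fin n) ℝ).transpose * M = 0}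
  zero_mem' := by simp
  add_mem' := by
    intro a b ha hb
    simp only [Set.mem_ofPred_eq] at ha hb ⊢
    have := congrArg₂ (· + ·) ha hb
    simp only [add_zero] at this
    rw [← this, Matrix.transpose_add, add_mul, mul_add]
    abel
  smul_mem' := by
    intro c a ha
    simp only [Set.mem_ofPred_eq] at ha ⊢
    rw [Matrix.transpose_smul, Matrix.smul_mul, Matrix.mul_smul, ← smul_add, ha, smul_zero]

theorem mem_tangentSpace {g : SO n} {M : Matrix (Fin n) (Fin n) ℝ} :
    M ∈ tangentSpace g ↔ M.transpose * (g : Matrix (Fin n) (Fin n) ℝ)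
      + (g : Matrix (Fin n) (Fin n) ℝ).transpose * M = 0 := Iff.rfl

/-- The differential `T_g SO(n) → T_{hg} SO(n)`, `u ↦ h u`, of the left multiplication by `h`. -/
def dLeft (h g : SO n) : tangentSpace g →ₗ[ℝ] tangentSpace (h * g) where
  toFun u := ⟨(h : Matrix (Fin n) (Fin n) ℝ) * (u : Matrix (Fin n) (Fin n) ℝ), by
    have hu := mem_tangentSpace.1 u.2
    rw [mem_tangentSpace, Submonoid.coe_mul, Matrix.transpose_mul, Matrix.transpose_mul]
    simp only [Matrix.mul_assoc]
    rw [← Matrix.mul_assoc (Matrix.transpose (h : Matrix (Fin n) (Fin n) ℝ)),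
      ← Matrix.mul_assoc (Matrix.transpose (h : Matrix (Fin n) (Fin n) ℝ)),
      SO.transpose_mul_self, Matrix.one_mul, Matrix.one_mul]
    exact hu⟩
  map_add' u v := Subtype.ext (by simp [mul_add])
  map_smul' c u := Subtype.ext (by simp)

/-- The differential `T_g SO(n) → T_{gh} SO(n)`, `u ↦ u h`, of the right multiplication by `h`. -/
def dRight (h g : SO n) : tangentSpace g →ₗ[ℝ] tangentSpace (g * h) where
  toFun u := ⟨(u : Matrix (Fin n) (Fin n) ℝ) * (h : Matrix (Fin n) (Fin n) ℝ), by
    have hu := mem_tangentSpace.1 u.2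
    rw [mem_tangentSpace, Submonoid.coe_mul, Matrix.transpose_mul, Matrix.transpose_mul]
    have := congrArg (fun A => (h : Matrix (Fin n) (Fin n) ℝ).transpose * A
      * (h : Matrix (Fin n) (Fin n) ℝ)) hu
    simpa only [mul_add, add_mul, Matrix.mul_assoc, Matrix.mul_zero, Matrix.zero_mul] using this⟩
  map_add' u v := Subtype.ext (by simp [add_mul])
  map_smul' c u := Subtype.ext (by simp)

/-! ### Riemannian metrics on `SO(n)` and their distances -/

/-- A Riemannian metric on `SO(n)`: an inner product on each tangent space `T_g SO(n)`, depending
smoothly on `g`. Smoothness says that the coefficients of the metric in the global smooth frame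
given by the fields `g ↦ g X`, `X ∈ T_e SO(n)`, are smooth functions on the closed submanifold
`SO(n)`, that is, restrictions of smooth functions of a matrix. -/
structure RiemannianMetric (n : ℕ) where
  inner : ∀ g : SO n, tangentSpace g →ₗ[ℝ] tangentSpace g →ₗ[ℝ] ℝ
  symm : ∀ (g : SO n) (u v : tangentSpace g), inner g u v = inner g v u
  pos : ∀ (g : SO n) (u : tangentSpace g), u ≠ 0 → 0 < inner g u u
  smooth : ∀ X Y : tangentSpace (1 : SO n), ∃ F : Matrix (Fin n) (Fin n) ℝ → ℝ,
    ContDiff ℝ ∞ F ∧ ∀ g : SO n, F (g : Matrix (Fin n) (Fin n) ℝ)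
      = inner (g * 1) (dLeft g 1 X) (dLeft g 1 Y)

/-- A Riemannian metric is bi-invariant if all left and all right multiplications are isometries. -/
def RiemannianMetric.IsBiInvariant (G : RiemannianMetric n) : Prop :=
  ∀ (h g : SO n) (u v : tangentSpace g),
    G.inner (h * g) (dLeft h g u) (dLeft h g v) = G.inner g u v ∧
    G.inner (g * h) (dRight h g u) (dRight h g v) = G.inner g u v

theorem derivWithin_mem_tangentSpace (γ : ℝ → SO n) (t : ℝ) :
    derivWithin (fun s => (γ s : Matrix (Fin n) (Fin n) ℝ)) (Set.Icc 0 1) t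
      ∈ tangentSpace (γ t) := by
  set f : ℝ → Matrix (Fin n) (Fin n) ℝ := fun s => (γ s : Matrix (Fin n) (Fin n) ℝ) with hf
  by_cases hd : DifferentiableWithinAt ℝ f (Set.Icc 0 1) t
  swap
  · rw [derivWithin_zero_of_not_differentiableWithinAt hd]
    exact Submodule.zero_mem _
  by_cases ht : t ∈ Set.Icc (0 : ℝ) 1
  swap
  · have h0 : derivWithin f (Set.Icc 0 1) t = 0 :=
      derivWithin_zero_of_notMem_closure (by rwa [(isClosed_Icc (a := (0 : ℝ))).closure_eq])
    rw [h0]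
    exact Submodule.zero_mem _
  have hu : UniqueDiffWithinAt ℝ (Set.Icc (0 : ℝ) 1) t := uniqueDiffOn_Icc_zero_one t ht
  have hF := hd.hasDerivWithinAt
  set M := derivWithin f (Set.Icc 0 1) t with hM
  have hent : ∀ i j, HasDerivWithinAt (fun s => f s i j) (M i j) (Set.Icc 0 1) t := fun i j =>
    hasDerivWithinAt_pi.1 (hasDerivWithinAt_pi.1 hF i) j
  rw [mem_tangentSpace]
  ext i j
  have h1 : HasDerivWithinAt (fun s => ∑ k, f s k i * f s k j)
      (∑ k, (M k i * f t k j + f t k i * M k j)) (Set.Icc 0 1) t :=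
    HasDerivWithinAt.fun_sum fun k _ => (hent k i).mul (hent k j)
  have h2 : (fun s => ∑ k, f s k i * f s k j)
      = fun _ => (1 : Matrix (Fin n) (Fin n) ℝ) i j := by
    funext s
    rw [← SO.transpose_mul_self (γ s)]
    simp [Matrix.mul_apply, hf]
  rw [h2] at h1
  have h3 := hu.eq_deriv _ h1 (hasDerivWithinAt_const t _ _)
  simpa [Matrix.mul_apply, Finset.sum_add_distrib, hf] using h3

/-- The velocity at time `t` of a curve in `SO(n)` parametrized by `[0, 1]` (one-sided at the end
points), as an element of the tangent space. -/
def velocity (γ : ℝ → SO n) (t : ℝ) : tangentSpace (γ t) :=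
  ⟨derivWithin (fun s => (γ s : Matrix (Fin n) (Fin n) ℝ)) (Set.Icc 0 1) t,
    derivWithin_mem_tangentSpace γ t⟩

/-- The length of a curve in `SO(n)` parametrized by `[0, 1]`. -/
def RiemannianMetric.length (G : RiemannianMetric n) (γ : ℝ → SO n) : ℝ :=
  ∫ t in (0 : ℝ)..1, √(G.inner (γ t) (velocity γ t) (velocity γ t))

/-- The Riemannian distance: the infimum of the lengths of the `C¹` curves `[0, 1] → SO(n)` from
`g` to `h`. (Only the restriction of `γ` to `[0, 1]` matters, and such curves exist, `SO(n)` being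
connected.) -/
def RiemannianMetric.dist (G : RiemannianMetric n) (g h : SO n) : ℝ :=
  sInf {ℓ : ℝ | ∃ γ : ℝ → SO n,
    ContDiffOn ℝ 1 (fun t => (γ t : Matrix (Fin n) (Fin n) ℝ)) (Set.Icc 0 1) ∧
    γ 0 = g ∧ γ 1 = h ∧ ℓ = G.length γ}

end Brownian

end

noncomputable section

namespace Brownian

variable {n : ℕ}

/-! ### The `Ad`-invariant form of a bi-invariant metric -/

/-! Negative type fails already on a copy of the alternating group A₄ acting on three of the
coordinates. Let `a`, `b` be rotations by π in two coordinate planes and `c` the cyclic permutation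
of the three coordinates. Weights +1 on the Klein group V = {1, a, b, ab} and -1 on the coset Vc
turn negative type into 3 d(1,a) ≤ 2 d(1,c) + 2 d(1,c⁻¹) (`RestrictedNegDef.three_mul_le`).
Bi-invariance is what makes all distances inside V equal, and likewise all distances from V to Vc.

Let L be the norm of an elementary generator for the Ad-invariant inner product on the Lie algebra.
The permutation `c` is a rotation by 2π/3 whose generator also has norm L (`form_diagGen`), so
d(1,c) and d(1,c⁻¹) are at most 2πL/3 and the right side is at most 8πL/3. On the other side d(1,a)
is morally πL, so the left side would be 3πL. Any bound d(1,a) > 8πL/9 gives a contradiction;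
17πL/18 is the one proved.

The lower bound must hold for every curve and every bi-invariant metric, with no classification of
such metrics. The element `a` sends another elementary generator E to -E under Ad. Along a curve γ
from 1 to `a`, the point Ad(γ)E runs on the sphere of radius L from E to the antipode -E. Its speed
is at most that of γ, because ad E is skew-adjoint with (ad E)³ = -ad E and hence a contraction
(`form_lie_planeGen_le`). So γ is essentially at least as long as half a great circle
(`le_length_of_flip`).

Positive definiteness of the Brownian kernel would imply negative type of d, since the base-point
terms vanish on weights of sum zero. On SO(4) the Pfaffian gives a second invariant quadratic form
besides the Frobenius one. -/

theorem SO.mul_transpose_self (g : SO n) :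
    (g : Matrix (Fin n) (Fin n) ℝ) * (g : Matrix (Fin n) (Fin n) ℝ).transpose = 1 :=
  mul_eq_one_comm.1 (SO.transpose_mul_self g)

theorem SO.coe_inv (g : SO n) :
    ((g⁻¹ : SO n) : Matrix (Fin n) (Fin n) ℝ) = (g : Matrix (Fin n) (Fin n) ℝ).transpose := rfl

theorem mem_tangentSpace_one {M : Matrix (Fin n) (Fin n) ℝ} :
    M ∈ tangentSpace (1 : SO n) ↔ M.transpose = -M := by
  rw [mem_tangentSpace, OneMemClass.coe_one, Matrix.transpose_one, one_mul, mul_one,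
    eq_neg_iff_add_eq_zero]

theorem transpose_mul_mem_tangentSpace_one {g : SO n} {M : Matrix (Fin n) (Fin n) ℝ}
    (h : M ∈ tangentSpace g) :
    (g : Matrix (Fin n) (Fin n) ℝ).transpose * M ∈ tangentSpace (1 : SO n) := by
  rw [mem_tangentSpace_one, eq_neg_iff_add_eq_zero, Matrix.transpose_mul,
    Matrix.transpose_transpose]
  exact mem_tangentSpace.1 h

/-- The skew-symmetric part of a matrix, in the Lie algebra of `SO(n)`. -/
def skewPart : Matrix (Fin n) (Fin n) ℝ →ₗ[ℝ] tangentSpace (1 : SO n) where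
  toFun M := ⟨(1 / 2 : ℝ) • (M - M.transpose), by
    rw [mem_tangentSpace_one]
    simp [← smul_neg]⟩
  map_add' M N := Subtype.ext (by simp only [Matrix.transpose_add, Submodule.coe_add]; module)
  map_smul' c M := Subtype.ext (by
    simp only [Matrix.transpose_smul, Submodule.coe_smul, RingHom.id_apply]; module)

theorem coe_skewPart (M : Matrix (Fin n) (Fin n) ℝ) :
    (skewPart M : Matrix (Fin n) (Fin n) ℝ) = (1 / 2 : ℝ) • (M - M.transpose) := rfl

theorem coe_skewPart_of_skew {M : Matrix (Fin n) (Fin n) ℝ} (hM : M.transpose = -M) :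
    (skewPart M : Matrix (Fin n) (Fin n) ℝ) = M := by
  rw [coe_skewPart, hM]; module

namespace RiemannianMetric

variable (G : RiemannianMetric n)

/-- Tangent spaces at equal points are distinct types; this allows the base point to be rewritten by
comparing underlying matrices only. -/
theorem inner_congr {g g' : SO n} (h : g = g') {u v : tangentSpace g} {u' v' : tangentSpace g'}
    (hu : (u : Matrix (Fin n) (Fin n) ℝ) = u') (hv : (v : Matrix (Fin n) (Fin n) ℝ) = v') :
    G.inner g u v = G.inner g' u' v' := by
  subst h
  rw [Subtype.ext hu, Subtype.ext hv]

/-- The inner product on the Lie algebra, extended to all matrices through the skew part. -/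
def form : LinearMap.BilinForm ℝ (Matrix (Fin n) (Fin n) ℝ) :=
  (G.inner 1).compl₁₂ skewPart skewPart

theorem form_apply (M N : Matrix (Fin n) (Fin n) ℝ) :
    G.form M N = G.inner 1 (skewPart M) (skewPart N) := rfl

theorem form_comm (M N : Matrix (Fin n) (Fin n) ℝ) : G.form M N = G.form N M :=
  G.symm _ _ _

theorem form_self_nonneg (M : Matrix (Fin n) (Fin n) ℝ) : 0 ≤ G.form M M := by
  rw [form_apply]
  by_cases h : skewPart M = 0
  · simp [h]
  · exact (G.pos _ _ h).le

theorem form_self_pos {M : Matrix (Fin n) (Fin n) ℝ} (hM : M.transpose = -M) (h : M ≠ 0) :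
    0 < G.form M M := by
  refine G.pos _ _ fun h0 => h ?_
  rw [← coe_skewPart_of_skew hM, h0, Submodule.coe_zero]

theorem form_mul_self_le (M N : Matrix (Fin n) (Fin n) ℝ) :
    G.form M N ^ 2 ≤ G.form M M * G.form N N :=
  LinearMap.BilinForm.apply_sq_le_of_symm G.form G.form_self_nonneg ⟨G.form_comm⟩ M N

variable {G} (hG : G.IsBiInvariant)
include hG

theorem IsBiInvariant.inner_eq_form {g : SO n} (u v : tangentSpace g) :
    G.inner g u v = G.form ((g : Matrix (Fin n) (Fin n) ℝ).transpose * u)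
      ((g : Matrix (Fin n) (Fin n) ℝ).transpose * v) := by
  rw [← (hG g⁻¹ g u v).1, form_apply]
  refine G.inner_congr (inv_mul_cancel g) ?_ ?_
  · rw [coe_skewPart_of_skew (mem_tangentSpace_one.1 (transpose_mul_mem_tangentSpace_one u.2))]
    rfl
  · rw [coe_skewPart_of_skew (mem_tangentSpace_one.1 (transpose_mul_mem_tangentSpace_one v.2))]
    rfl

/-- Ad-invariance: left translation by `h` followed by right translation by `h⁻¹` fixes the identity
and acts on its tangent space by conjugation. -/
theorem IsBiInvariant.form_conj (h : SO n) (M N : Matrix (Fin n) (Fin n) ℝ) :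
    G.form ((h : Matrix (Fin n) (Fin n) ℝ) * M * (h : Matrix (Fin n) (Fin n) ℝ).transpose)
      ((h : Matrix (Fin n) (Fin n) ℝ) * N * (h : Matrix (Fin n) (Fin n) ℝ).transpose)
      = G.form M N := by
  rw [form_apply, form_apply, ← (hG h 1 (skewPart M) (skewPart N)).1,
    ← (hG h⁻¹ (h * 1) (dLeft h 1 (skewPart M)) (dLeft h 1 (skewPart N))).2]
  have key : ∀ A : Matrix (Fin n) (Fin n) ℝ,
      (skewPart ((h : Matrix (Fin n) (Fin n) ℝ) * A
        * (h : Matrix (Fin n) (Fin n) ℝ).transpose) : Matrix (Fin n) (Fin n) ℝ)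
      = (h : Matrix (Fin n) (Fin n) ℝ) * (skewPart A : Matrix (Fin n) (Fin n) ℝ)
        * (h : Matrix (Fin n) (Fin n) ℝ).transpose := fun A => by
    simp only [coe_skewPart, Matrix.transpose_mul, Matrix.transpose_transpose, Matrix.mul_smul,
      Matrix.smul_mul, mul_sub, sub_mul, mul_assoc]
  exact G.inner_congr (by simp) (key M) (key N)

theorem IsBiInvariant.form_conj' (h : SO n) (M N : Matrix (Fin n) (Fin n) ℝ) :
    G.form ((h : Matrix (Fin n) (Fin n) ℝ).transpose * M * (h : Matrix (Fin n) (Fin n) ℝ))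
      ((h : Matrix (Fin n) (Fin n) ℝ).transpose * N * (h : Matrix (Fin n) (Fin n) ℝ))
      = G.form M N := by
  have := hG.form_conj h⁻¹ M N
  rwa [SO.coe_inv, Matrix.transpose_transpose] at this

end RiemannianMetric

/-! ### Lengths and distances -/

theorem _root_.HasDerivWithinAt.matrix_mul {f g : ℝ → Matrix (Fin n) (Fin n) ℝ}
    {f' g' : Matrix (Fin n) (Fin n) ℝ} {s : Set ℝ} {t : ℝ} (hf : HasDerivWithinAt f f' s t)
    (hg : HasDerivWithinAt g g' s t) :
    HasDerivWithinAt (fun x => f x * g x) (f' * g t + f t * g') s t := by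
  refine hasDerivWithinAt_pi.2 fun i => hasDerivWithinAt_pi.2 fun j => ?_
  simp only [Matrix.mul_apply, Matrix.add_apply, ← Finset.sum_add_distrib]
  exact HasDerivWithinAt.fun_sum fun k _ =>
    (hasDerivWithinAt_pi.1 (hasDerivWithinAt_pi.1 hf i) k).mul
      (hasDerivWithinAt_pi.1 (hasDerivWithinAt_pi.1 hg k) j)

theorem _root_.HasDerivWithinAt.matrix_transpose {f : ℝ → Matrix (Fin n) (Fin n) ℝ}
    {f' : Matrix (Fin n) (Fin n) ℝ} {s : Set ℝ} {t : ℝ} (hf : HasDerivWithinAt f f' s t) :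
    HasDerivWithinAt (fun x => (f x).transpose) f'.transpose s t :=
  hasDerivWithinAt_pi.2 fun i => hasDerivWithinAt_pi.2 fun j =>
    hasDerivWithinAt_pi.1 (hasDerivWithinAt_pi.1 hf j) i

/-- The derivative on `[0, 1]` of a curve in `SO(n)`, translated to the Lie algebra. -/
def logVelocity (γ : ℝ → SO n) (t : ℝ) : Matrix (Fin n) (Fin n) ℝ :=
  (γ t : Matrix (Fin n) (Fin n) ℝ).transpose
    * derivWithin (fun s => (γ s : Matrix (Fin n) (Fin n) ℝ)) (Set.Icc 0 1) t

theorem transpose_logVelocity (γ : ℝ → SO n) (t : ℝ) :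
    (logVelocity γ t).transpose = -logVelocity γ t :=
  mem_tangentSpace_one.1 (transpose_mul_mem_tangentSpace_one (velocity γ t).2)

theorem logVelocity_eq {γ : ℝ → SO n} {t : ℝ} (ht : t ∈ Set.Icc (0 : ℝ) 1)
    {M : Matrix (Fin n) (Fin n) ℝ} (h : HasDerivWithinAt
      (fun s => (γ s : Matrix (Fin n) (Fin n) ℝ)) M (Set.Icc 0 1) t) :
    logVelocity γ t = (γ t : Matrix (Fin n) (Fin n) ℝ).transpose * M :=
  congrArg _ (h.derivWithin (uniqueDiffOn_Icc_zero_one t ht))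

theorem mul_logVelocity (γ : ℝ → SO n) (t : ℝ) :
    (γ t : Matrix (Fin n) (Fin n) ℝ) * logVelocity γ t
      = derivWithin (fun s => (γ s : Matrix (Fin n) (Fin n) ℝ)) (Set.Icc 0 1) t := by
  rw [logVelocity, ← mul_assoc, SO.mul_transpose_self, one_mul]

theorem hasDerivWithinAt_of_contDiffOn {γ : ℝ → SO n}
    (hγ : ContDiffOn ℝ 1 (fun t => (γ t : Matrix (Fin n) (Fin n) ℝ)) (Set.Icc 0 1))
    {t : ℝ} (ht : t ∈ Set.Icc (0 : ℝ) 1) :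
    HasDerivWithinAt (fun s => (γ s : Matrix (Fin n) (Fin n) ℝ))
      ((γ t : Matrix (Fin n) (Fin n) ℝ) * logVelocity γ t) (Set.Icc 0 1) t := by
  rw [mul_logVelocity]
  exact (hγ.differentiableOn one_ne_zero t ht).hasDerivWithinAt

theorem contDiffOn_mul_mul {γ : ℝ → SO n}
    (hγ : ContDiffOn ℝ 1 (fun t => (γ t : Matrix (Fin n) (Fin n) ℝ)) (Set.Icc 0 1)) (a b : SO n) :
    ContDiffOn ℝ 1 (fun t => ((a * γ t * b : SO n) : Matrix (Fin n) (Fin n) ℝ)) (Set.Icc 0 1) :=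
  ((LinearMap.mulLeft ℝ (a : Matrix (Fin n) (Fin n) ℝ) ∘ₗ
    LinearMap.mulRight ℝ (b : Matrix (Fin n) (Fin n) ℝ)).toContinuousLinearMap.contDiff.comp_contDiffOn
      hγ).congr fun _ _ => mul_assoc _ _ _

theorem logVelocity_mul_mul {γ : ℝ → SO n}
    (hγ : ContDiffOn ℝ 1 (fun t => (γ t : Matrix (Fin n) (Fin n) ℝ)) (Set.Icc 0 1)) (a b : SO n)
    {t : ℝ} (ht : t ∈ Set.Icc (0 : ℝ) 1) :
    logVelocity (fun s => a * γ s * b) t = (b : Matrix (Fin n) (Fin n) ℝ).transpose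
      * logVelocity γ t * (b : Matrix (Fin n) (Fin n) ℝ) := by
  have h := ((hasDerivWithinAt_const t (Set.Icc (0 : ℝ) 1)
    (a : Matrix (Fin n) (Fin n) ℝ)).matrix_mul (hasDerivWithinAt_of_contDiffOn hγ ht)).matrix_mul
      (hasDerivWithinAt_const t (Set.Icc (0 : ℝ) 1) (b : Matrix (Fin n) (Fin n) ℝ))
  rw [logVelocity_eq ht h]
  simp only [zero_mul, zero_add, mul_zero, add_zero, Submonoid.coe_mul, Matrix.transpose_mul,
    mul_assoc]
  rw [← mul_assoc (a : Matrix (Fin n) (Fin n) ℝ).transpose, SO.transpose_mul_self, one_mul,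
    ← mul_assoc (γ t : Matrix (Fin n) (Fin n) ℝ).transpose, SO.transpose_mul_self, one_mul]

theorem continuousOn_logVelocity {γ : ℝ → SO n}
    (hγ : ContDiffOn ℝ 1 (fun t => (γ t : Matrix (Fin n) (Fin n) ℝ)) (Set.Icc 0 1)) :
    ContinuousOn (logVelocity γ) (Set.Icc 0 1) := by
  have h1 := hγ.continuousOn
  have h2 := hγ.continuousOn_derivWithin uniqueDiffOn_Icc_zero_one le_rfl
  rw [continuousOn_iff_continuous_domRestrict] at h1 h2 ⊢
  exact h1.matrix_transpose.matrix_mul h2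

namespace RiemannianMetric

variable {G : RiemannianMetric n}

theorem length_nonneg (γ : ℝ → SO n) : 0 ≤ G.length γ :=
  intervalIntegral.integral_nonneg zero_le_one fun _ _ => Real.sqrt_nonneg _

theorem dist_nonneg (g h : SO n) : 0 ≤ G.dist g h := by
  refine Real.sInf_nonneg ?_
  rintro _ ⟨γ, -, -, -, rfl⟩
  exact length_nonneg γ

theorem dist_le_length {γ : ℝ → SO n}
    (hγ : ContDiffOn ℝ 1 (fun t => (γ t : Matrix (Fin n) (Fin n) ℝ)) (Set.Icc 0 1)) :
    G.dist (γ 0) (γ 1) ≤ G.length γ := by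
  refine csInf_le ⟨0, ?_⟩ ⟨γ, hγ, rfl, rfl, rfl⟩
  rintro _ ⟨γ, -, -, -, rfl⟩
  exact length_nonneg γ

theorem continuousOn_sqrt_form {γ : ℝ → SO n}
    (hγ : ContDiffOn ℝ 1 (fun t => (γ t : Matrix (Fin n) (Fin n) ℝ)) (Set.Icc 0 1)) :
    ContinuousOn (fun t => √(G.form (logVelocity γ t) (logVelocity γ t))) (Set.Icc 0 1) := by
  have h := continuousOn_logVelocity hγ
  exact ((G.form.toContinuousBilinearMap.continuous.comp_continuousOn h).clm_apply h).sqrt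

variable (hG : G.IsBiInvariant)
include hG

theorem IsBiInvariant.length_eq (γ : ℝ → SO n) :
    G.length γ = ∫ t in (0 : ℝ)..1, √(G.form (logVelocity γ t) (logVelocity γ t)) := by
  simp only [length, hG.inner_eq_form]
  rfl

theorem IsBiInvariant.length_mul_mul {γ : ℝ → SO n}
    (hγ : ContDiffOn ℝ 1 (fun t => (γ t : Matrix (Fin n) (Fin n) ℝ)) (Set.Icc 0 1)) (a b : SO n) :
    G.length (fun t => a * γ t * b) = G.length γ := by
  rw [hG.length_eq, hG.length_eq]
  refine intervalIntegral.integral_congr fun t ht => ?_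
  rw [Set.uIcc_of_le zero_le_one] at ht
  simp only [logVelocity_mul_mul hγ a b ht, hG.form_conj']

theorem IsBiInvariant.dist_mul_mul (a b g h : SO n) :
    G.dist (a * g * b) (a * h * b) = G.dist g h := by
  have key : ∀ a b g h : SO n, {ℓ : ℝ | ∃ γ : ℝ → SO n,
      ContDiffOn ℝ 1 (fun t => (γ t : Matrix (Fin n) (Fin n) ℝ)) (Set.Icc 0 1) ∧
      γ 0 = g ∧ γ 1 = h ∧ ℓ = G.length γ} ⊆ {ℓ : ℝ | ∃ γ : ℝ → SO n,
      ContDiffOn ℝ 1 (fun t => (γ t : Matrix (Fin n) (Fin n) ℝ)) (Set.Icc 0 1) ∧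
      γ 0 = a * g * b ∧ γ 1 = a * h * b ∧ ℓ = G.length γ} := by
    rintro a b g h _ ⟨γ, hγ, rfl, rfl, rfl⟩
    exact ⟨_, contDiffOn_mul_mul hγ a b, rfl, rfl, (hG.length_mul_mul hγ a b).symm⟩
  refine congrArg sInf (Set.Subset.antisymm ?_ (key a b g h))
  have := key a⁻¹ b⁻¹ (a * g * b) (a * h * b)
  simpa only [mul_assoc, inv_mul_cancel_left, mul_inv_cancel, mul_one] using this

end RiemannianMetric

/-! ### Rotations of angle `t` generated by `Y` -/

/-- A skew-symmetric matrix with `Y³ = -Y` generates rotations whose angles are all equal. -/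
structure IsRotationGenerator (Y : Matrix (Fin n) (Fin n) ℝ) : Prop where
  skew : Y.transpose = -Y
  cube : Y * (Y * Y) = -Y

/-- The exponential of `t Y`, for a matrix with `Y³ = -Y`. -/
def rotation (Y : Matrix (Fin n) (Fin n) ℝ) (t : ℝ) : Matrix (Fin n) (Fin n) ℝ :=
  1 + Real.sin t • Y + (1 - Real.cos t) • (Y * Y)

theorem rotation_zero (Y : Matrix (Fin n) (Fin n) ℝ) : rotation Y 0 = 1 := by simp [rotation]

theorem contDiff_rotation (Y : Matrix (Fin n) (Fin n) ℝ) (θ : ℝ) :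
    ContDiff ℝ 1 (fun t => rotation Y (t * θ)) := by
  unfold rotation
  fun_prop

namespace IsRotationGenerator

variable {Y : Matrix (Fin n) (Fin n) ℝ} (hY : IsRotationGenerator Y)
include hY

theorem neg : IsRotationGenerator (-Y) :=
  ⟨by rw [Matrix.transpose_neg, hY.skew], by rw [neg_mul_neg, neg_mul, hY.cube]⟩

theorem rotation_mul_rotation (s t : ℝ) : rotation Y s * rotation Y t = rotation Y (s + t) := by
  simp only [rotation, add_mul, mul_add, one_mul, mul_one, Matrix.smul_mul, Matrix.mul_smul,
    mul_assoc, hY.cube, mul_neg, Real.sin_add, Real.cos_add]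
  module

theorem transpose_rotation (t : ℝ) : (rotation Y t).transpose = rotation Y (-t) := by
  simp [rotation, hY.skew]

theorem rotation_mem (t : ℝ) : rotation Y t ∈ Matrix.specialOrthogonalGroup (Fin n) ℝ := by
  have h : ∀ s, rotation Y s * (rotation Y s).transpose = 1 := fun s => by
    rw [hY.transpose_rotation, hY.rotation_mul_rotation, add_neg_cancel, rotation_zero]
  refine Matrix.mem_specialOrthogonalGroup_iff.2
    ⟨(Matrix.mem_orthogonalGroup_iff (Fin n) ℝ).2 (h t), ?_⟩
  -- The rotation by `t` is the square of the rotation by `t / 2`, whose determinant squares to 1.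
  have h2 := congrArg Matrix.det (h (t / 2))
  rw [Matrix.det_mul, Matrix.det_transpose, Matrix.det_one] at h2
  rw [← add_halves t, ← hY.rotation_mul_rotation, Matrix.det_mul, h2]

/-- The rotation of angle `t` generated by `Y`, in `SO(n)`. -/
def rotationSO (t : ℝ) : SO n := ⟨rotation Y t, hY.rotation_mem t⟩

theorem hasDerivWithinAt_rotation (θ t : ℝ) (s : Set ℝ) :
    HasDerivWithinAt (fun t => rotation Y (t * θ)) (rotation Y (t * θ) * θ • Y) s t := by
  have hm : HasDerivAt (fun t : ℝ => t * θ) θ t := by simpa using (hasDerivAt_id t).mul_const θ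
  have h := ((hm.sin.smul_const Y).const_add 1).add
    (((hm.cos.const_sub 1)).smul_const (Y * Y))
  refine (h.congr_deriv ?_).hasDerivWithinAt
  have h3 : Y * Y * Y = -Y := by rw [mul_assoc, hY.cube]
  simp only [rotation, add_mul, one_mul, Matrix.smul_mul, Matrix.mul_smul, h3]
  module

theorem exists_length_eq {G : RiemannianMetric n} (hG : G.IsBiInvariant) (θ : ℝ) :
    ∃ γ : ℝ → SO n,
      ContDiffOn ℝ 1 (fun t => (γ t : Matrix (Fin n) (Fin n) ℝ)) (Set.Icc 0 1) ∧
      γ 0 = 1 ∧ γ 1 = hY.rotationSO θ ∧ |θ| * √(G.form Y Y) = G.length γ := by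
  refine ⟨fun t => hY.rotationSO (t * θ), (contDiff_rotation Y θ).contDiffOn,
    Subtype.ext (by simp [rotationSO, rotation_zero]), by simp, ?_⟩
  rw [hG.length_eq]
  have h : ∀ t ∈ Set.uIcc (0 : ℝ) 1,
      √(G.form (logVelocity (fun t => hY.rotationSO (t * θ)) t)
        (logVelocity (fun t => hY.rotationSO (t * θ)) t)) = |θ| * √(G.form Y Y) := by
    intro t ht
    rw [Set.uIcc_of_le zero_le_one] at ht
    rw [logVelocity_eq ht (hY.hasDerivWithinAt_rotation θ t _)]
    have : ((hY.rotationSO (t * θ) : SO n) : Matrix (Fin n) (Fin n) ℝ).transpose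
        * (rotation Y (t * θ) * θ • Y) = θ • Y := by
      rw [← mul_assoc]
      exact (congrArg (· * θ • Y) (SO.transpose_mul_self (hY.rotationSO (t * θ)))).trans
        (one_mul _)
    rw [this, map_smul, map_smul, LinearMap.smul_apply, smul_eq_mul, smul_eq_mul, ← mul_assoc,
      ← sq, Real.sqrt_mul (sq_nonneg θ), Real.sqrt_sq_eq_abs]
  rw [intervalIntegral.integral_congr h]
  simp

theorem dist_rotationSO_le {G : RiemannianMetric n} (hG : G.IsBiInvariant) (θ : ℝ) :
    G.dist 1 (hY.rotationSO θ) ≤ |θ| * √(G.form Y Y) := by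
  obtain ⟨γ, hγ, h0, h1, h⟩ := hY.exists_length_eq hG θ
  rw [h, ← h0, ← h1]
  exact RiemannianMetric.dist_le_length hγ

end IsRotationGenerator

/-! ### Elementary rotations -/

/-- The generator of the rotations in the plane of the coordinates `i` and `j`. -/
def planeGen (i j : Fin n) : Matrix (Fin n) (Fin n) ℝ :=
  Matrix.single i j 1 - Matrix.single j i 1

theorem isRotationGenerator_planeGen {i j : Fin n} (h : i ≠ j) :
    IsRotationGenerator (planeGen i j) := by
  constructor
  · simp [planeGen]
  · simp [planeGen, mul_sub, sub_mul, h, h.symm]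
    abel

theorem planeGen_ne_zero {i j : Fin n} (h : i ≠ j) : planeGen i j ≠ 0 := by
  intro h0
  have := congrFun (congrFun h0 i) j
  simp [planeGen, h, h.symm] at this

/-- Only the block of `X` on the coordinates `i`, `j` survives, and a skew 2 × 2 block is a multiple
of the generator. In particular E X E commutes with E, which drives the next two identities. -/
theorem planeGen_mul_mul_planeGen (i j : Fin n) {X : Matrix (Fin n) (Fin n) ℝ}
    (hX : X.transpose = -X) :
    planeGen i j * X * planeGen i j = X j i • planeGen i j := by
  have hs : ∀ k l, X k l = -X l k := fun k l => congrFun (congrFun hX l) k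
  have h0 : ∀ k, X k k = 0 := fun k => by linarith [hs k k]
  simp only [planeGen, sub_mul, mul_sub, Matrix.single_mul_mul_single, h0, hs i j]
  simp [Matrix.smul_single, ← Matrix.single_neg, sub_eq_add_neg]

variable {i j : Fin n}

theorem transpose_lie_of_skew {X Y : Matrix (Fin n) (Fin n) ℝ} (hX : X.transpose = -X)
    (hY : Y.transpose = -Y) : ⁅X, Y⁆.transpose = -⁅X, Y⁆ := by
  rw [Ring.lie_def, Matrix.transpose_sub, Matrix.transpose_mul, Matrix.transpose_mul, hX, hY]
  noncomm_ring

/-- Expanding the triple bracket gives E³X - 3E²XE + 3EXE² - XE³; the middle terms cancel because E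
X E commutes with E, and E³ = -E. -/
theorem lie_lie_lie_planeGen (hij : i ≠ j) {X : Matrix (Fin n) (Fin n) ℝ}
    (hX : X.transpose = -X) :
    ⁅planeGen i j, ⁅planeGen i j, ⁅planeGen i j, X⁆⁆⁆ = -⁅planeGen i j, X⁆ := by
  have h3 := (isRotationGenerator_planeGen hij).cube
  have hp := planeGen_mul_mul_planeGen i j hX
  set E := planeGen i j
  have h1 : E * (E * X * E) = E * X * E * E := by
    rw [hp, Matrix.mul_smul, Matrix.smul_mul]
  calc ⁅E, ⁅E, ⁅E, X⁆⁆⁆ = E * (E * E) * X - 3 • (E * (E * X * E)) + 3 • (E * X * E * E)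
        - X * (E * (E * E)) := by simp only [Ring.lie_def]; noncomm_ring
    _ = -⁅E, X⁆ := by rw [h1, h3, Ring.lie_def]; noncomm_ring

/-- This is Ad(R) - Ad(R⁻¹) = 2 ad E for the quarter turn R, an instance of Ad(exp tE) = 1 + sin t ·
ad E + (1 - cos t) · (ad E)². It extracts ad E from group elements without differentiating. -/
theorem conj_rotation_planeGen (hij : i ≠ j) {X : Matrix (Fin n) (Fin n) ℝ}
    (hX : X.transpose = -X) :
    rotation (planeGen i j) (Real.pi / 2) * X * (rotation (planeGen i j) (Real.pi / 2)).transpose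
      - (rotation (planeGen i j) (Real.pi / 2)).transpose * X
        * rotation (planeGen i j) (Real.pi / 2) = (2 : ℝ) • ⁅planeGen i j, X⁆ := by
  rw [(isRotationGenerator_planeGen hij).transpose_rotation]
  have hp := planeGen_mul_mul_planeGen i j hX
  set E := planeGen i j
  have h1 : E * (E * X * E) = E * X * E * E := by
    rw [hp, Matrix.mul_smul, Matrix.smul_mul]
  simp only [rotation, Real.sin_neg, Real.cos_neg, Real.sin_pi_div_two, Real.cos_pi_div_two,
    sub_zero, one_smul, neg_smul]
  calc (1 + E + E * E) * X * (1 + -E + E * E) - (1 + -E + E * E) * X * (1 + E + E * E)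
      = 2 • (E * X - X * E) + 2 • (E * X * E * E - E * (E * X * E)) := by noncomm_ring
    _ = (2 : ℝ) • ⁅E, X⁆ := by rw [h1, sub_self, smul_zero, add_zero, Ring.lie_def, two_smul, two_smul]

namespace RiemannianMetric

variable {G : RiemannianMetric n} (hG : G.IsBiInvariant)
include hG

/-- Ad(R) is an isometry whose adjoint is Ad(R⁻¹), so the difference Ad(R) - Ad(R⁻¹) = 2 ad E is
skew-adjoint. -/
theorem IsBiInvariant.form_lie_planeGen (hij : i ≠ j) {X Z : Matrix (Fin n) (Fin n) ℝ}
    (hX : X.transpose = -X) (hZ : Z.transpose = -Z) :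
    G.form ⁅planeGen i j, X⁆ Z = -G.form X ⁅planeGen i j, Z⁆ := by
  have hE := isRotationGenerator_planeGen hij
  set R : SO n := hE.rotationSO (Real.pi / 2) with hR
  have hX2 := conj_rotation_planeGen hij hX
  have hZ2 := conj_rotation_planeGen hij hZ
  change (R : Matrix (Fin n) (Fin n) ℝ) * X * (R : Matrix (Fin n) (Fin n) ℝ).transpose
    - (R : Matrix (Fin n) (Fin n) ℝ).transpose * X * (R : Matrix (Fin n) (Fin n) ℝ) = _ at hX2
  change (R : Matrix (Fin n) (Fin n) ℝ) * Z * (R : Matrix (Fin n) (Fin n) ℝ).transpose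
    - (R : Matrix (Fin n) (Fin n) ℝ).transpose * Z * (R : Matrix (Fin n) (Fin n) ℝ) = _ at hZ2
  have move : ∀ A C : Matrix (Fin n) (Fin n) ℝ,
      G.form ((R : Matrix (Fin n) (Fin n) ℝ) * A * (R : Matrix (Fin n) (Fin n) ℝ).transpose) C
      = G.form A ((R : Matrix (Fin n) (Fin n) ℝ).transpose * C
        * (R : Matrix (Fin n) (Fin n) ℝ)) := fun A C => by
    rw [← hG.form_conj R A]
    congr 1
    rw [mul_assoc, mul_assoc _ (R : Matrix (Fin n) (Fin n) ℝ),
      SO.mul_transpose_self, mul_one, ← mul_assoc, SO.mul_transpose_self, one_mul]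
  have e1 := congrArg (fun A => G.form A Z) hX2
  have e2 := congrArg (fun A => G.form X A) hZ2
  simp only [map_sub, map_smul, LinearMap.sub_apply, LinearMap.smul_apply, smul_eq_mul, move]
    at e1 e2
  have e3 := move Z X
  rw [G.form_comm, G.form_comm Z] at e3
  linarith

theorem IsBiInvariant.form_lie_planeGen_self (hij : i ≠ j) {X : Matrix (Fin n) (Fin n) ℝ}
    (hX : X.transpose = -X) : G.form ⁅planeGen i j, X⁆ (planeGen i j) = 0 := by
  rw [hG.form_lie_planeGen hij hX (isRotationGenerator_planeGen hij).skew, Ring.lie_def, sub_self,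
    map_zero, neg_zero]

/-- The adjoint action of an elementary generator is a contraction. -/
theorem IsBiInvariant.form_lie_planeGen_le (hij : i ≠ j) {X : Matrix (Fin n) (Fin n) ℝ}
    (hX : X.transpose = -X) :
    G.form ⁅planeGen i j, X⁆ ⁅planeGen i j, X⁆ ≤ G.form X X := by
  have hE := (isRotationGenerator_planeGen hij).skew
  have h1 := transpose_lie_of_skew hE hX
  have h2 := transpose_lie_of_skew hE h1
  have hT := lie_lie_lie_planeGen hij hX
  have e1 := hG.form_lie_planeGen hij hX h1
  have e2 := hG.form_lie_planeGen hij h1 h2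
  rw [hT, map_neg, neg_neg] at e2
  -- With T = ad E skew and T³ = -T, one has ⟨X, T²X⟩ = -|TX|² and |T²X|² = |TX|², so |X + T²X|² =
  -- |X|² - |TX|².
  have h0 := G.form_self_nonneg (X + ⁅planeGen i j, ⁅planeGen i j, X⁆⁆)
  simp only [map_add, LinearMap.add_apply] at h0
  rw [G.form_comm ⁅planeGen i j, ⁅planeGen i j, X⁆⁆ X] at h0
  linarith

end RiemannianMetric

/-! ### A lower bound for the length of curves -/

namespace RiemannianMetric

variable {G : RiemannianMetric n}

/-- Cauchy–Schwarz in the orthogonal complement of `Z`. -/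
theorem form_sq_le_of_orthogonal {W Z Y : Matrix (Fin n) (Fin n) ℝ} (hWZ : G.form W Z = 0)
    (hZ : G.form Z Z = G.form Y Y) (hY : 0 < G.form Y Y) :
    G.form W Y ^ 2 ≤ G.form W W * (G.form Y Y - G.form Z Y ^ 2 / G.form Y Y) := by
  -- `W` pairs with `Y` as it does with the component of `Y` orthogonal to `Z`.
  have h := G.form_mul_self_le W (Y - (G.form Z Y / G.form Y Y) • Z)
  simp only [map_sub, map_smul, LinearMap.sub_apply, LinearMap.smul_apply, smul_eq_mul, hWZ,
    hZ, mul_zero, sub_zero, G.form_comm Y Z] at h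
  refine h.trans_eq (congrArg _ ?_)
  field_simp
  ring

/-- With X = γ⁻¹γ', the derivative of Ad(γ)A is Ad(γ)[X, A]. -/
theorem hasDerivWithinAt_form_conj {γ : ℝ → SO n}
    (hγ : ContDiffOn ℝ 1 (fun t => (γ t : Matrix (Fin n) (Fin n) ℝ)) (Set.Icc 0 1))
    (A : Matrix (Fin n) (Fin n) ℝ) {t : ℝ} (ht : t ∈ Set.Icc (0 : ℝ) 1) :
    HasDerivWithinAt (fun t => G.form ((γ t : Matrix (Fin n) (Fin n) ℝ) * A
        * (γ t : Matrix (Fin n) (Fin n) ℝ).transpose) A)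
      (-G.form ((γ t : Matrix (Fin n) (Fin n) ℝ) * ⁅A, logVelocity γ t⁆
        * (γ t : Matrix (Fin n) (Fin n) ℝ).transpose) A) (Set.Icc 0 1) t := by
  have h1 := hasDerivWithinAt_of_contDiffOn hγ ht
  have h2 := (h1.matrix_mul (hasDerivWithinAt_const t (Set.Icc (0 : ℝ) 1) A)).matrix_mul
    h1.matrix_transpose
  have h3 := (G.form.flip A).toContinuousLinearMap.hasFDerivAt.comp_hasDerivWithinAt t h2
  refine h3.congr_deriv ?_
  change G.form _ A = _
  rw [← LinearMap.neg_apply, ← map_neg, Matrix.transpose_mul, transpose_logVelocity,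
    Ring.lie_def]
  congr 2
  noncomm_ring

variable (hG : G.IsBiInvariant) {i j : Fin n}
include hG

/-- A curve that moves the elementary generator `E` to `-E` by the adjoint action is long. -/
theorem IsBiInvariant.le_length_of_flip (hij : i ≠ j) {γ : ℝ → SO n}
    (hγ : ContDiffOn ℝ 1 (fun t => (γ t : Matrix (Fin n) (Fin n) ℝ)) (Set.Icc 0 1))
    (h0 : γ 0 = 1) (h1 : (γ 1 : Matrix (Fin n) (Fin n) ℝ) * planeGen i j
      * (γ 1 : Matrix (Fin n) (Fin n) ℝ).transpose = -planeGen i j)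
    {r : ℝ} (hr0 : 0 < r) (hr1 : r < 1) :
    2 * Real.arcsin r * √(G.form (planeGen i j) (planeGen i j)) ≤ G.length γ := by
  set E := planeGen i j with hE
  have hEs : E.transpose = -E := (isRotationGenerator_planeGen hij).skew
  have hpos : 0 < G.form E E := G.form_self_pos hEs (planeGen_ne_zero hij)
  set N := G.form E E with hN
  -- `φ` is the cosine of the angle between Ad(γ)E and E, and `s` below is the speed of γ measured
  -- in units of the norm of E.
  set φ : ℝ → ℝ := fun t => G.form ((γ t : Matrix (Fin n) (Fin n) ℝ) * E
        * (γ t : Matrix (Fin n) (Fin n) ℝ).transpose) E / N with hφ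
  set φ' : ℝ → ℝ := fun t => -G.form ((γ t : Matrix (Fin n) (Fin n) ℝ) * ⁅E, logVelocity γ t⁆
        * (γ t : Matrix (Fin n) (Fin n) ℝ).transpose) E / N with hφ'
  set s : ℝ → ℝ := fun t => √(G.form (logVelocity γ t) (logVelocity γ t)) / √N with hs
  have hd : ∀ t ∈ Set.Icc (0 : ℝ) 1, HasDerivWithinAt φ (φ' t) (Set.Icc 0 1) t := fun t ht =>
    (hasDerivWithinAt_form_conj hγ E ht).div_const N
  have hφ2 : ∀ t, φ t ^ 2 ≤ 1 := fun t => by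
    have h := G.form_mul_self_le ((γ t : Matrix (Fin n) (Fin n) ℝ) * E
        * (γ t : Matrix (Fin n) (Fin n) ℝ).transpose) E
    rw [hG.form_conj] at h
    rw [hφ, div_pow, div_le_one (by positivity)]
    linarith
  -- For φ = cos θ this says |θ'| ≤ s. The factor 1 - φ² comes from [E, X] being orthogonal to E, so
  -- that the velocity of Ad(γ)E is tangent to the sphere.
  have hbound : ∀ t, φ' t ^ 2 ≤ s t ^ 2 * (1 - φ t ^ 2) := fun t => by
    have hX := transpose_logVelocity γ t
    have h := form_sq_le_of_orthogonal (G := G)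
      (W := (γ t : Matrix (Fin n) (Fin n) ℝ) * ⁅E, logVelocity γ t⁆
        * (γ t : Matrix (Fin n) (Fin n) ℝ).transpose)
      (Z := (γ t : Matrix (Fin n) (Fin n) ℝ) * E
        * (γ t : Matrix (Fin n) (Fin n) ℝ).transpose) (Y := E)
      ((hG.form_conj _ _ _).trans (hG.form_lie_planeGen_self hij hX)) (hG.form_conj _ _ _) hpos
    rw [hG.form_conj, ← hN] at h
    have hlie := hG.form_lie_planeGen_le hij hX
    have hnn : 0 ≤ N - G.form ((γ t : Matrix (Fin n) (Fin n) ℝ) * E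
        * (γ t : Matrix (Fin n) (Fin n) ℝ).transpose) E ^ 2 / N := by
      have := hφ2 t
      rw [hφ, div_pow, div_le_one (by positivity)] at this
      rw [sub_nonneg, div_le_iff₀ hpos]
      linarith
    have h' := h.trans (mul_le_mul_of_nonneg_right hlie hnn)
    simp only [hφ', hφ, hs, div_pow, neg_sq]
    rw [Real.sq_sqrt (G.form_self_nonneg _), Real.sq_sqrt hpos.le, div_le_iff₀ (by positivity)]
    refine h'.trans_eq ?_
    field_simp
  have hs0 : ∀ t, 0 ≤ s t := fun t => by positivity
  have hsq : ∀ t, 0 < 1 - (r * φ t) ^ 2 := fun t => by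
    rw [mul_pow]
    nlinarith [hφ2 t, sq_nonneg (φ t), mul_pos hr0 hr0]
  have hsint : IntervalIntegrable s MeasureTheory.volume 0 1 := by
    refine ContinuousOn.intervalIntegrable ?_
    rw [Set.uIcc_of_le zero_le_one]
    exact (continuousOn_sqrt_form hγ).div_const _
  -- The factor r < 1 keeps the argument away from ±1, where arcsin is not differentiable and where
  -- `φ` starts and ends. The price is 2 arcsin r in place of π.
  have key : Real.arcsin (r * φ 0) - Real.arcsin (r * φ 1) ≤ ∫ t in (0 : ℝ)..1, s t := by
    have hcont : ContinuousOn (fun t => -Real.arcsin (r * φ t)) (Set.Icc 0 1) :=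
      (Real.continuous_arcsin.comp_continuousOn
        (continuousOn_const.mul fun t ht => (hd t ht).continuousWithinAt)).neg
    have h := intervalIntegral.sub_le_integral_of_hasDeriv_right_of_le zero_le_one hcont
      (g' := fun t => -(1 / √(1 - (r * φ t) ^ 2) * (r * φ' t))) (φ := s) ?_ ?_ ?_
    · linarith
    · intro t ht
      have hne : r * φ t ≠ -1 ∧ r * φ t ≠ 1 := by
        constructor <;> intro h <;> have := hsq t <;> rw [h] at this <;> norm_num at this
      have hda := ((hd t (Set.Ioo_subset_Icc_self ht)).hasDerivAt
        (Icc_mem_nhds ht.1 ht.2)).const_mul r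
      exact ((Real.hasDerivAt_arcsin hne.1 hne.2).comp t hda).neg.hasDerivWithinAt
    · rwa [intervalIntegrable_iff_integrableOn_Icc_of_le zero_le_one] at hsint
    · intro t _
      have hsqrt : 0 < √(1 - (r * φ t) ^ 2) := Real.sqrt_pos.2 (hsq t)
      have h2 : |r * φ' t| ≤ s t * √(1 - (r * φ t) ^ 2) := by
        refine abs_le_of_sq_le_sq ?_ (mul_nonneg (hs0 t) hsqrt.le)
        rw [mul_pow, mul_pow, Real.sq_sqrt (hsq t).le]
        have hr2 : r ^ 2 ≤ 1 := by nlinarith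
        -- Here r²(1 - φ²) ≤ 1 - r²φ², as r² ≤ 1.
        nlinarith [mul_le_mul_of_nonneg_left (hbound t) (sq_nonneg r),
          mul_nonneg (sq_nonneg (s t)) (sub_nonneg.2 hr2)]
      have h3 := (abs_le.1 h2).1
      rw [one_div_mul_eq_div, ← neg_div, div_le_iff₀ hsqrt]
      linarith
  have hφ0 : φ 0 = 1 := by
    simp only [hφ, h0, OneMemClass.coe_one, one_mul, Matrix.transpose_one, mul_one]
    exact div_self hpos.ne'
  have hφ1 : φ 1 = -1 := by
    simp only [hφ, h1, map_neg, LinearMap.neg_apply, neg_div]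
    rw [div_self hpos.ne']
  rw [hφ0, hφ1, mul_neg_one, mul_one, Real.arcsin_neg, intervalIntegral.integral_div,
    ← hG.length_eq, le_div_iff₀ (Real.sqrt_pos.2 hpos)] at key
  linarith

/-- The half turn in the plane of `i`, `j` negates the coordinate `j` and fixes `k`, hence flips the
generator of the plane of `j`, `k`. -/
theorem IsBiInvariant.le_dist_rotation_pi {k : Fin n} (hij : i ≠ j) (hik : i ≠ k) (hjk : j ≠ k) :
    17 / 18 * Real.pi * √(G.form (planeGen j k) (planeGen j k))
      ≤ G.dist 1 ((isRotationGenerator_planeGen hij).rotationSO Real.pi) := by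
  obtain ⟨γ₀, h₀⟩ := (isRotationGenerator_planeGen hij).exists_length_eq hG Real.pi
  -- The infimum of the empty set would be 0, so the lower bound needs some curve; the one-parameter
  -- group provides it.
  refine le_csInf ⟨_, γ₀, h₀.1, h₀.2.1, h₀.2.2.1, rfl⟩ ?_
  rintro _ ⟨γ, hγ, h0, h1, rfl⟩
  have hpi := Real.pi_pos
  have hflip : (γ 1 : Matrix (Fin n) (Fin n) ℝ) * planeGen j k
      * (γ 1 : Matrix (Fin n) (Fin n) ℝ).transpose = -planeGen j k := by
    rw [h1]
    simp only [IsRotationGenerator.rotationSO, rotation, planeGen]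
    simp [add_mul, mul_add, sub_mul, mul_sub, hij, hij.symm, hik, hik.symm, hjk, hjk.symm]
    simp only [Matrix.single_add]
    module
  -- Any angle strictly between 4π/9 and π/2 would serve for arcsin r; 17π/36 is the midpoint.
  have h := hG.le_length_of_flip hjk hγ h0 hflip (r := Real.sin (17 / 36 * Real.pi))
    (Real.sin_pos_of_pos_of_lt_pi (by linarith) (by linarith)) (by
      rw [← Real.sin_pi_div_two]
      exact Real.sin_lt_sin_of_lt_of_le_pi_div_two (by linarith) le_rfl (by linarith))
  rw [Real.arcsin_sin (by linarith) (by linarith)] at h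
  refine le_trans (le_of_eq ?_) h
  ring

end RiemannianMetric

/-! ### Restricted negative definite kernels -/

/-- Weights +1 on the points `x` and -1 on the points `y`. -/
theorem RestrictedNegDef.sum_le {X : Type*} {d : X → X → ℝ} (h : RestrictedNegDef d) {m : ℕ}
    (x y : Fin m → X) :
    ∑ p, ∑ q, d (x p) (x q) + ∑ p, ∑ q, d (y p) (y q)
      ≤ ∑ p, ∑ q, d (x p) (y q) + ∑ p, ∑ q, d (y p) (x q) := by
  have := h (m + m) (Fin.append x y) (Fin.append (fun _ => 1) fun _ => -1)
    (by simp only [Fin.sum_univ_add, Fin.append_left, Fin.append_right]; simp)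
  simp only [Fin.sum_univ_add, Fin.append_left, Fin.append_right, map_neg, map_one, mul_one,
    mul_neg, Finset.sum_neg_distrib, Finset.sum_add_distrib, Complex.add_re,
    Complex.neg_re, Complex.re_sum, Complex.ofReal_re] at this
  linarith

/-- The terms d(x, x₀) and d(y, x₀) depend on one index only, so they disappear for weights of sum
zero, leaving -d/2. -/
theorem PosDefKernel.restrictedNegDef {X : Type*} {d : X → X → ℝ} {x₀ : X}
    (h : PosDefKernel (brownianKernel d x₀)) : RestrictedNegDef d := by
  intro m x ξ hξ
  have h1 := h m x ξ
  have hξ' : ∑ j, (starRingEnd ℂ) (ξ j) = 0 := by rw [← map_sum, hξ, map_zero]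
  have h2 : ∑ p, ∑ q, (brownianKernel d x₀ (x p) (x q) : ℂ) * ξ p * (starRingEnd ℂ) (ξ q)
      = (1 / 2 : ℝ) * (∑ p, (d (x p) x₀ * ξ p) * ∑ q, (starRingEnd ℂ) (ξ q)
        + (∑ p, ξ p) * ∑ q, d (x q) x₀ * (starRingEnd ℂ) (ξ q)
        - ∑ p, ∑ q, (d (x p) (x q) : ℂ) * ξ p * (starRingEnd ℂ) (ξ q)) := by
    rw [Finset.sum_mul_sum]
    simp only [Finset.mul_sum, ← Finset.sum_add_distrib, ← Finset.sum_sub_distrib]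
    refine Finset.sum_congr rfl fun p _ => Finset.sum_congr rfl fun q _ => ?_
    simp only [brownianKernel]
    push_cast
    ring
  rw [h2, hξ, hξ', Complex.re_ofReal_mul] at h1
  simp only [mul_zero, zero_mul, Finset.sum_const_zero, zero_add, zero_sub, Complex.neg_re] at h1
  linarith

/-- The obstruction: in a copy of the alternating group `A₄`, the Klein four-group and one of its
cosets are a configuration on which a bi-invariant kernel fails to be of negative type as soon as
the elements of order `3` are too close to the identity compared with those of order `2`. -/
theorem RestrictedNegDef.three_mul_le {H : Type*} [Group H] {d : H → H → ℝ}
    (h : RestrictedNegDef d) (hd0 : ∀ g, 0 ≤ d g g)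
    (hd : ∀ s t g k, d (s * g * t) (s * k * t) = d g k)
    {a b c : H} (ha : a * a = 1) (hb : b * b = 1) (hab : b * a = a * b)
    (hca : c * a = b * c) (hcb : c * b = a * b * c) :
    3 * d 1 a ≤ 2 * d 1 c + 2 * d 1 c⁻¹ := by
  have hone : ∀ g k, d g k = d 1 (g⁻¹ * k) := fun g k => by simpa using (hd g⁻¹ 1 g k).symm
  have hconj : ∀ w g, d 1 (w * g * w⁻¹) = d 1 g := fun w g => by simpa using hd w w⁻¹ 1 g
  have hai : a⁻¹ = a := inv_eq_of_mul_eq_one_right ha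
  have hbi : b⁻¹ = b := inv_eq_of_mul_eq_one_right hb
  have ha' : ∀ g, a * (a * g) = g := fun g => by rw [← mul_assoc, ha, one_mul]
  have hb' : ∀ g, b * (b * g) = g := fun g => by rw [← mul_assoc, hb, one_mul]
  have hab' : ∀ g, b * (a * g) = a * (b * g) := fun g => by
    rw [← mul_assoc, hab, mul_assoc]
  -- Conjugation by `c` permutes a → b → ab, so the three involutions are equally far from 1.
  have hdb : d 1 b = d 1 a := by rw [← hconj c a, hca, mul_inv_cancel_right]
  have hdab : d 1 (a * b) = d 1 a := by rw [← hdb, ← hconj c b, hcb, mul_inv_cancel_right]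
  set V : Fin 4 → H := ![1, a, b, a * b] with hV
  have hVV : ∀ p q, p ≠ q → d (V p) (V q) = d 1 a := by
    intro p q hpq
    rw [hone]
    fin_cases p <;> fin_cases q <;>
      first
      | exact absurd rfl hpq
      | simp [hV, hai, hbi, hb, hab, ha', hab', hdb, hdab, mul_assoc]
  -- As w runs through V, the conjugates w c w⁻¹ exhaust the coset Vc; so every difference between a
  -- point of V and a point of Vc is conjugate to `c`.
  have hVc : ∀ p q, ∃ w, (V p)⁻¹ * (V q * c) = w * c * w⁻¹ := by
    have h1 : ∃ w, c = w * c * w⁻¹ := ⟨1, by simp⟩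
    have h2 : ∃ w, a * c = w * c * w⁻¹ := ⟨b, by
      rw [hbi, mul_assoc, hcb, ← mul_assoc, ← mul_assoc, hab, mul_assoc a, hb, mul_one]⟩
    have h3 : ∃ w, b * c = w * c * w⁻¹ := ⟨a * b, by
      rw [mul_inv_rev, hai, hbi, mul_assoc, ← mul_assoc c, hcb, mul_assoc, mul_assoc (a * b) c,
        hca]
      simp only [mul_assoc, ha', hb', hab']⟩
    have h4 : ∃ w, a * (b * c) = w * c * w⁻¹ := ⟨a, by rw [hai, mul_assoc, hca]⟩
    intro p q
    fin_cases p <;> fin_cases q <;>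
      simpa [hV, hai, hbi, ha, hb, hab, ha', hb', hab', mul_assoc] using
        (by assumption : ∃ w, _ = w * c * w⁻¹)
  have hx : ∀ p q, d (V p) (V q * c) = d 1 c := fun p q => by
    obtain ⟨w, hw⟩ := hVc p q
    rw [hone, hw, hconj]
  have hy : ∀ p q, d (V p * c) (V q) = d 1 c⁻¹ := fun p q => by
    obtain ⟨w, hw⟩ := hVc q p
    have : (V p * c)⁻¹ * V q = w * c⁻¹ * w⁻¹ := by
      rw [← inv_inv ((V p * c)⁻¹ * V q), mul_inv_rev, inv_inv, hw]
      group
    rw [hone, this, hconj]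
  -- There are 12 ordered pairs of distinct points in V; on the diagonal nonnegativity is enough.
  have hlow : 12 * d 1 a ≤ ∑ p, ∑ q, d (V p) (V q) := by
    have hpq : ∀ p q, (if p = q then 0 else d 1 a) ≤ d (V p) (V q) := fun p q => by
      split_ifs with hpq
      · rw [hpq]; exact hd0 _
      · exact (hVV p q hpq).ge
    refine le_trans (le_of_eq ?_)
      (Finset.sum_le_sum fun p _ => Finset.sum_le_sum fun q _ => hpq p q)
    simp [Fin.sum_univ_four]
    ring
  have hmain := h.sum_le V fun p => V p * c
  have hdc : ∀ p q, d (V p * c) (V q * c) = d (V p) (V q) := fun p q => by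
    simpa using hd 1 c (V p) (V q)
  simp only [hx, hy, hdc, Finset.sum_const, Finset.card_univ, Fintype.card_fin, nsmul_eq_mul,
    Nat.cast_ofNat] at hmain
  linarith

/-! ### Cyclic permutation of three coordinates as a rotation -/

/-- The generator of the rotations about the main diagonal of the coordinates `i`, `j`, `k`. -/
def diagGen (i j k : Fin n) : Matrix (Fin n) (Fin n) ℝ :=
  (1 / √3) • (planeGen j i + planeGen k j + planeGen i k)

section

variable {i j k : Fin n} (hij : i ≠ j) (hik : i ≠ k) (hjk : j ≠ k)
include hij hik hjk

theorem isRotationGenerator_diagGen : IsRotationGenerator (diagGen i j k) := by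
  have h3 : (√3 : ℝ) * √3 = 3 := Real.mul_self_sqrt (by norm_num)
  have h0 : (√3 : ℝ) ≠ 0 := by positivity
  -- On the three coordinates this sum is the cross product with (1, 1, 1), a vector of length √3;
  -- hence S³ = -3S and the normalization of `diagGen`.
  have hS : (planeGen j i + planeGen k j + planeGen i k)
      * ((planeGen j i + planeGen k j + planeGen i k)
        * (planeGen j i + planeGen k j + planeGen i k))
      = (-3 : ℝ) • (planeGen j i + planeGen k j + planeGen i k) := by
    simp only [planeGen, add_mul, mul_add, sub_mul, mul_sub, Matrix.single_mul_single_same,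
      Matrix.single_mul_single_of_ne, hij, hij.symm, hik, hik.symm, hjk, hjk.symm, ne_eq,
      not_false_eq_true, mul_one, mul_zero]
    module
  constructor
  · simp only [diagGen, planeGen, Matrix.transpose_smul, Matrix.transpose_add,
      Matrix.transpose_sub, Matrix.transpose_single]
    module
  · simp only [diagGen, Matrix.smul_mul, Matrix.mul_smul, hS]
    rw [smul_smul, smul_smul, smul_smul, ← neg_smul]
    congr 1
    field_simp
    linarith

/-- A third of a turn about the diagonal is the cyclic permutation e_i → e_j → e_k → e_i, the
element of order 3 in A₄. -/
theorem rotation_diagGen : rotation (diagGen i j k) (2 * Real.pi / 3)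
    = 1 - Matrix.single i i 1 - Matrix.single j j 1 - Matrix.single k k 1
      + Matrix.single j i 1 + Matrix.single k j 1 + Matrix.single i k 1 := by
  have h3 : (√3 : ℝ) * √3 = 3 := Real.mul_self_sqrt (by norm_num)
  have h0 : (√3 : ℝ) ≠ 0 := by positivity
  have hang : 2 * Real.pi / 3 = Real.pi - Real.pi / 3 := by ring
  have e1 : √3 / 2 * (1 / √3) = 1 / 2 := by field_simp
  have e2 : (1 - -(1 / 2)) * (1 / √3 * (1 / √3)) = 1 / 2 := by
    field_simp
    linarith
  rw [rotation, hang, Real.sin_pi_sub, Real.cos_pi_sub, Real.sin_pi_div_three,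
    Real.cos_pi_div_three, diagGen, Matrix.smul_mul, Matrix.mul_smul, smul_smul, smul_smul,
    smul_smul, e1, mul_assoc, e2]
  simp only [planeGen, add_mul, mul_add, sub_mul, mul_sub, Matrix.single_mul_single_same,
    Matrix.single_mul_single_of_ne, hij, hij.symm, hik, hik.symm, hjk, hjk.symm, ne_eq,
    not_false_eq_true, mul_one]
  module

omit hik hjk in
theorem rotation_planeGen_pi : rotation (planeGen i j) Real.pi
    = 1 - (2 : ℝ) • Matrix.single i i 1 - (2 : ℝ) • Matrix.single j j 1 := by
  rw [rotation, Real.sin_pi, Real.cos_pi]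
  simp only [planeGen, sub_mul, mul_sub, Matrix.single_mul_single_same,
    Matrix.single_mul_single_of_ne, hij, hij.symm, ne_eq, not_false_eq_true, mul_one]
  module

variable {G : RiemannianMetric n} (hG : G.IsBiInvariant)
include hG

/-- The cyclic permutation conjugates one generator into the other. -/
theorem RiemannianMetric.IsBiInvariant.form_planeGen_succ :
    G.form (planeGen k j) (planeGen k j) = G.form (planeGen j i) (planeGen j i) := by
  rw [← hG.form_conj ((isRotationGenerator_diagGen hij hik hjk).rotationSO (2 * Real.pi / 3))
    (planeGen j i)]
  have : ((isRotationGenerator_diagGen hij hik hjk).rotationSO (2 * Real.pi / 3)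
        : Matrix (Fin n) (Fin n) ℝ) * planeGen j i
      * ((isRotationGenerator_diagGen hij hik hjk).rotationSO (2 * Real.pi / 3)
        : Matrix (Fin n) (Fin n) ℝ).transpose = planeGen k j := by
    simp only [IsRotationGenerator.rotationSO, rotation_diagGen hij hik hjk]
    simp only [planeGen, Matrix.transpose_add, Matrix.transpose_sub, Matrix.transpose_one,
      Matrix.transpose_single, add_mul, mul_add, sub_mul, mul_sub, one_mul, mul_one,
      Matrix.single_mul_single_same, Matrix.single_mul_single_of_ne, hij, hij.symm, hik, hik.symm,
      hjk, hjk.symm, ne_eq, not_false_eq_true, zero_mul]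
    abel
  rw [this]

/-- Conjugation by the half turn in the plane of `i`, `j` fixes the first generator and negates the
second, so Ad-invariance makes them orthogonal. -/
theorem RiemannianMetric.IsBiInvariant.form_planeGen_planeGen :
    G.form (planeGen j i) (planeGen k j) = 0 := by
  have h := hG.form_conj ((isRotationGenerator_planeGen hij).rotationSO Real.pi)
    (planeGen j i) (planeGen k j)
  have e1 : ((isRotationGenerator_planeGen hij).rotationSO Real.pi : Matrix (Fin n) (Fin n) ℝ)
      * planeGen j i * ((isRotationGenerator_planeGen hij).rotationSO Real.pi
        : Matrix (Fin n) (Fin n) ℝ).transpose = planeGen j i := by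
    simp only [IsRotationGenerator.rotationSO, rotation_planeGen_pi hij]
    simp only [planeGen, Matrix.transpose_smul, Matrix.transpose_sub, Matrix.transpose_one,
      Matrix.transpose_single, sub_mul, mul_sub, one_mul, mul_one, Matrix.smul_mul,
      Matrix.mul_smul, Matrix.single_mul_single_same, Matrix.single_mul_single_of_ne, hij,
      hij.symm, ne_eq, not_false_eq_true, zero_mul]
    module
  have e2 : ((isRotationGenerator_planeGen hij).rotationSO Real.pi : Matrix (Fin n) (Fin n) ℝ)
      * planeGen k j * ((isRotationGenerator_planeGen hij).rotationSO Real.pi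
        : Matrix (Fin n) (Fin n) ℝ).transpose = -planeGen k j := by
    simp only [IsRotationGenerator.rotationSO, rotation_planeGen_pi hij]
    simp only [planeGen, Matrix.transpose_smul, Matrix.transpose_sub, Matrix.transpose_one,
      Matrix.transpose_single, sub_mul, mul_sub, one_mul, mul_one, Matrix.smul_mul,
      Matrix.mul_smul, Matrix.single_mul_single_same, Matrix.single_mul_single_of_ne, hij,
      hij.symm, hik, hik.symm, hjk, hjk.symm, ne_eq, not_false_eq_true, zero_mul]
    module
  rw [e1, e2, map_neg] at h
  linarith

/-- Pythagoras: three orthogonal generators of equal norm, divided by √3. -/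
theorem RiemannianMetric.IsBiInvariant.form_diagGen :
    G.form (diagGen i j k) (diagGen i j k) = G.form (planeGen k j) (planeGen k j) := by
  have h3 : (√3 : ℝ) * √3 = 3 := Real.mul_self_sqrt (by norm_num)
  have n1 := hG.form_planeGen_succ hij hik hjk
  have n2 := hG.form_planeGen_succ hjk hij.symm hik.symm
  have o1 := hG.form_planeGen_planeGen hij hik hjk
  have o2 := hG.form_planeGen_planeGen hjk hij.symm hik.symm
  have o3 := hG.form_planeGen_planeGen hik.symm hjk.symm hij
  have o1' := (G.form_comm _ _).trans o1
  have o2' := (G.form_comm _ _).trans o2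
  have o3' := (G.form_comm _ _).trans o3
  simp only [diagGen, map_smul, map_add, LinearMap.smul_apply, LinearMap.add_apply, smul_eq_mul,
    o1, o2, o3, o1', o2', o3', n2, ← n1]
  field_simp
  linear_combination (-G.form (planeGen k j) (planeGen k j)) * h3

/-- A bi-invariant Riemannian distance on `SO(n)`, `n ≥ 3`, is not of negative type. -/
theorem RiemannianMetric.IsBiInvariant.not_restrictedNegDef : ¬ RestrictedNegDef G.dist := by
  intro h
  have hc := isRotationGenerator_diagGen hij hik hjk
  have hD := hG.le_dist_rotation_pi hij hik hjk
  have hC := hc.dist_rotationSO_le hG (2 * Real.pi / 3)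
  have hC' := hc.dist_rotationSO_le hG (-(2 * Real.pi / 3))
  have hpi := Real.pi_pos
  have hinv : hc.rotationSO (-(2 * Real.pi / 3)) = (hc.rotationSO (2 * Real.pi / 3))⁻¹ :=
    Subtype.ext (hc.transpose_rotation _).symm
  have hneg : planeGen k j = -planeGen j k := (neg_sub _ _).symm
  rw [abs_of_pos (by positivity), hG.form_diagGen hij hik hjk, hneg] at hC
  rw [abs_neg, abs_of_pos (by positivity), hG.form_diagGen hij hik hjk, hneg, hinv] at hC'
  simp only [map_neg, LinearMap.neg_apply, neg_neg] at hC hC'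
  have hL : 0 < Real.pi * √(G.form (planeGen j k) (planeGen j k)) :=
    mul_pos hpi (Real.sqrt_pos.2 (G.form_self_pos (isRotationGenerator_planeGen hjk).skew
      (planeGen_ne_zero hjk)))
  have key := h.three_mul_le (fun g => dist_nonneg g g) hG.dist_mul_mul
    (a := (isRotationGenerator_planeGen hij).rotationSO Real.pi)
    (b := (isRotationGenerator_planeGen hjk).rotationSO Real.pi)
    (c := hc.rotationSO (2 * Real.pi / 3)) ?_ ?_ ?_ ?_ ?_
  -- With L the common norm, 3 · (17/18)πL = 17πL/6 exceeds 4 · (2π/3)L = 16πL/6.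
  · linarith
  all_goals
    refine Subtype.ext ?_
    simp only [Submonoid.coe_mul, OneMemClass.coe_one, IsRotationGenerator.rotationSO,
      rotation_planeGen_pi hij, rotation_planeGen_pi hjk, rotation_diagGen hij hik hjk]
    simp only [add_mul, mul_add, sub_mul, mul_sub, one_mul, mul_one, Matrix.smul_mul,
      Matrix.mul_smul, Matrix.single_mul_single_same, Matrix.single_mul_single_of_ne, hij,
      hij.symm, hik, hik.symm, hjk, hjk.symm, ne_eq, not_false_eq_true, zero_mul]
    module

end

/-! ### Bi-invariant metrics from invariant forms -/

/-- The left-invariant Riemannian metric given by an inner product on the Lie algebra. -/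
def RiemannianMetric.ofForm (B : LinearMap.BilinForm ℝ (Matrix (Fin n) (Fin n) ℝ))
    (hs : ∀ M N, B M N = B N M)
    (hp : ∀ M : Matrix (Fin n) (Fin n) ℝ, M.transpose = -M → M ≠ 0 → 0 < B M M) :
    RiemannianMetric n where
  inner g := B.compl₁₂
    (LinearMap.mulLeft ℝ (g : Matrix (Fin n) (Fin n) ℝ).transpose ∘ₗ (tangentSpace g).subtype)
    (LinearMap.mulLeft ℝ (g : Matrix (Fin n) (Fin n) ℝ).transpose ∘ₗ (tangentSpace g).subtype)
  symm g u v := hs _ _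
  pos g u hu := by
    refine hp _ (mem_tangentSpace_one.1 (transpose_mul_mem_tangentSpace_one u.2)) fun h => hu ?_
    have h' : (g : Matrix (Fin n) (Fin n) ℝ).transpose * (u : Matrix (Fin n) (Fin n) ℝ) = 0 := h
    refine Subtype.ext ?_
    rw [← one_mul (u : Matrix (Fin n) (Fin n) ℝ), ← SO.mul_transpose_self g, mul_assoc, h',
      mul_zero, Submodule.coe_zero]
  smooth X Y := by
    -- A left-invariant metric has constant coefficients in the left-invariant frame.
    refine ⟨fun _ => B X Y, contDiff_const, fun g => ?_⟩
    have h : ∀ Z : tangentSpace (1 : SO n), ((g * 1 : SO n) : Matrix (Fin n) (Fin n) ℝ).transpose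
        * (dLeft g 1 Z : Matrix (Fin n) (Fin n) ℝ) = Z := fun Z => by
      change _ * ((g : Matrix (Fin n) (Fin n) ℝ) * (Z : Matrix (Fin n) (Fin n) ℝ)) = _
      rw [mul_one, ← mul_assoc, SO.transpose_mul_self, one_mul]
    exact congrArg₂ (fun M N => B M N) (h X).symm (h Y).symm

theorem RiemannianMetric.ofForm_isBiInvariant
    (B : LinearMap.BilinForm ℝ (Matrix (Fin n) (Fin n) ℝ)) (hs : ∀ M N, B M N = B N M)
    (hp : ∀ M : Matrix (Fin n) (Fin n) ℝ, M.transpose = -M → M ≠ 0 → 0 < B M M)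
    (hB : ∀ (h : SO n) (M N : Matrix (Fin n) (Fin n) ℝ), M.transpose = -M → N.transpose = -N →
      B ((h : Matrix (Fin n) (Fin n) ℝ).transpose * M * (h : Matrix (Fin n) (Fin n) ℝ))
        ((h : Matrix (Fin n) (Fin n) ℝ).transpose * N * (h : Matrix (Fin n) (Fin n) ℝ)) = B M N) :
    (RiemannianMetric.ofForm B hs hp).IsBiInvariant := by
  intro h g u v
  constructor
  · have hl : ∀ w : tangentSpace g, ((h * g : SO n) : Matrix (Fin n) (Fin n) ℝ).transpose
        * (dLeft h g w : Matrix (Fin n) (Fin n) ℝ)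
        = (g : Matrix (Fin n) (Fin n) ℝ).transpose * (w : Matrix (Fin n) (Fin n) ℝ) := fun w => by
      change _ * ((h : Matrix (Fin n) (Fin n) ℝ) * (w : Matrix (Fin n) (Fin n) ℝ)) = _
      rw [Submonoid.coe_mul, Matrix.transpose_mul, mul_assoc,
        ← mul_assoc _ (h : Matrix (Fin n) (Fin n) ℝ), SO.transpose_mul_self, one_mul]
    exact congrArg₂ (fun M N => B M N) (hl u) (hl v)
  · have hr : ∀ w : tangentSpace g, ((g * h : SO n) : Matrix (Fin n) (Fin n) ℝ).transpose
        * (dRight h g w : Matrix (Fin n) (Fin n) ℝ)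
        = (h : Matrix (Fin n) (Fin n) ℝ).transpose * ((g : Matrix (Fin n) (Fin n) ℝ).transpose
          * (w : Matrix (Fin n) (Fin n) ℝ)) * (h : Matrix (Fin n) (Fin n) ℝ) := fun w => by
      change _ * ((w : Matrix (Fin n) (Fin n) ℝ) * (h : Matrix (Fin n) (Fin n) ℝ)) = _
      rw [Submonoid.coe_mul, Matrix.transpose_mul]
      simp only [mul_assoc]
    exact (congrArg₂ (fun M N => B M N) (hr u) (hr v)).trans (hB h _ _
      (mem_tangentSpace_one.1 (transpose_mul_mem_tangentSpace_one u.2))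
      (mem_tangentSpace_one.1 (transpose_mul_mem_tangentSpace_one v.2)))

/-- The Frobenius inner product of matrices. -/
def frobeniusForm (n : ℕ) : LinearMap.BilinForm ℝ (Matrix (Fin n) (Fin n) ℝ) :=
  LinearMap.mk₂ ℝ (fun M N => (M.transpose * N).trace)
    (fun M M' N => by simp [add_mul]) (fun c M N => by simp)
    (fun M N N' => by simp [mul_add]) (fun c M N => by simp)

theorem frobeniusForm_apply (M N : Matrix (Fin n) (Fin n) ℝ) :
    frobeniusForm n M N = (M.transpose * N).trace := rfl

theorem frobeniusForm_comm (M N : Matrix (Fin n) (Fin n) ℝ) :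
    frobeniusForm n M N = frobeniusForm n N M := by
  rw [frobeniusForm_apply, ← Matrix.trace_transpose, Matrix.transpose_mul,
    Matrix.transpose_transpose, frobeniusForm_apply]

theorem frobeniusForm_self_pos {M : Matrix (Fin n) (Fin n) ℝ} (h : M ≠ 0) :
    0 < frobeniusForm n M M := by
  have h0 : frobeniusForm n M M = ∑ j, ∑ i, M i j ^ 2 := by
    simp [frobeniusForm_apply, Matrix.trace, Matrix.mul_apply, sq]
  rw [h0]
  refine lt_of_le_of_ne (by positivity) fun h1 => h ?_
  ext i j
  rw [eq_comm, Finset.sum_eq_zero_iff_of_nonneg fun _ _ => by positivity] at h1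
  have h2 := h1 j (Finset.mem_univ _)
  rw [Finset.sum_eq_zero_iff_of_nonneg fun _ _ => by positivity] at h2
  exact pow_eq_zero_iff two_ne_zero |>.1 (h2 i (Finset.mem_univ _))

theorem frobeniusForm_conj (h : SO n) (M N : Matrix (Fin n) (Fin n) ℝ) :
    frobeniusForm n
      ((h : Matrix (Fin n) (Fin n) ℝ).transpose * M * (h : Matrix (Fin n) (Fin n) ℝ))
      ((h : Matrix (Fin n) (Fin n) ℝ).transpose * N * (h : Matrix (Fin n) (Fin n) ℝ))
      = frobeniusForm n M N := by
  rw [frobeniusForm_apply, frobeniusForm_apply, Matrix.transpose_mul, Matrix.transpose_mul,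
    Matrix.transpose_transpose, ← mul_assoc, Matrix.trace_mul_comm]
  congr 1
  calc _ = ((h : Matrix (Fin n) (Fin n) ℝ) * (h : Matrix (Fin n) (Fin n) ℝ).transpose)
        * (M.transpose * (((h : Matrix (Fin n) (Fin n) ℝ)
          * (h : Matrix (Fin n) (Fin n) ℝ).transpose) * N)) := by simp only [mul_assoc]
    _ = _ := by rw [SO.mul_transpose_self, one_mul, one_mul]

/-- The polarization of twice the Pfaffian of `4 × 4` skew-symmetric matrices. -/
def pfaffianForm : LinearMap.BilinForm ℝ (Matrix (Fin 4) (Fin 4) ℝ) :=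
  LinearMap.mk₂ ℝ (fun M N => M 0 1 * N 2 3 + M 2 3 * N 0 1 - M 0 2 * N 1 3 - M 1 3 * N 0 2
      + M 0 3 * N 1 2 + M 1 2 * N 0 3)
    (fun M M' N => by simp only [Matrix.add_apply]; ring)
    (fun c M N => by simp only [Matrix.smul_apply, smul_eq_mul]; ring)
    (fun M N N' => by simp only [Matrix.add_apply]; ring)
    (fun c M N => by simp only [Matrix.smul_apply, smul_eq_mul]; ring)

theorem pfaffianForm_apply (M N : Matrix (Fin 4) (Fin 4) ℝ) :
    pfaffianForm M N = M 0 1 * N 2 3 + M 2 3 * N 0 1 - M 0 2 * N 1 3 - M 1 3 * N 0 2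
      + M 0 3 * N 1 2 + M 1 2 * N 0 3 := rfl

theorem eq_of_skew_four {M : Matrix (Fin 4) (Fin 4) ℝ} (hM : M.transpose = -M) :
    M = !![0, M 0 1, M 0 2, M 0 3; -M 0 1, 0, M 1 2, M 1 3;
      -M 0 2, -M 1 2, 0, M 2 3; -M 0 3, -M 1 3, -M 2 3, 0] := by
  have hs : ∀ i j, M j i = -M i j := fun i j => congrFun (congrFun hM i) j
  have h0 : ∀ i, M i i = 0 := fun i => by linarith [hs i i]
  ext i j
  fin_cases i <;> fin_cases j <;> simp [h0, hs 0 1, hs 0 2, hs 0 3, hs 1 2, hs 1 3, hs 2 3]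

/-- Polarized form of Pf(gᵀMg) = det g · Pf M, checked by expansion in the entries. On SO(4) the
determinant is 1, so this form is Ad-invariant. -/
theorem pfaffianForm_mul_mul (g : Matrix (Fin 4) (Fin 4) ℝ) {M N : Matrix (Fin 4) (Fin 4) ℝ}
    (hM : M.transpose = -M) (hN : N.transpose = -N) :
    pfaffianForm (g.transpose * M * g) (g.transpose * N * g) = g.det * pfaffianForm M N := by
  rw [eq_of_skew_four hM, eq_of_skew_four hN]
  generalize M 0 1 = a, M 0 2 = b, M 0 3 = c, M 1 2 = d, M 1 3 = e, M 2 3 = f,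
    N 0 1 = a', N 0 2 = b', N 0 3 = c', N 1 2 = d', N 1 3 = e', N 2 3 = f'
  simp only [pfaffianForm_apply, Matrix.mul_apply, Matrix.det_succ_row_zero, Fin.sum_univ_succ,
    Matrix.transpose_apply]
  simp [Fin.succAbove]
  ring

theorem frobeniusForm_add_pfaffianForm_self_pos {M : Matrix (Fin 4) (Fin 4) ℝ} (hM : M.transpose = -M)
    (h : M ≠ 0) : 0 < frobeniusForm 4 M M + pfaffianForm M M := by
  have hpos := frobeniusForm_self_pos h
  -- This expression is twice the sum of the squares of m₀₁ + m₂₃, m₀₂ - m₁₃ and m₀₃ + m₁₂; the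
  -- remaining half of the Frobenius norm gives strict positivity.
  suffices 0 ≤ frobeniusForm 4 M M + 2 * pfaffianForm M M by linarith
  rw [eq_of_skew_four hM]
  simp only [frobeniusForm_apply, pfaffianForm_apply, Matrix.trace, Matrix.diag_apply,
    Matrix.mul_apply, Fin.sum_univ_four, Matrix.transpose_apply]
  simp
  nlinarith [sq_nonneg (M 0 1 + M 2 3), sq_nonneg (M 0 2 - M 1 3), sq_nonneg (M 0 3 + M 1 2)]

/-- `SO(4)` carries two bi-invariant Riemannian metrics that are not proportional. -/
theorem exists_not_proportional :
    ∃ G₁ G₂ : RiemannianMetric 4, G₁.IsBiInvariant ∧ G₂.IsBiInvariant ∧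
      ¬ ∃ c : ℝ, ∀ (g : SO 4) (u v : tangentSpace g), G₂.inner g u v = c * G₁.inner g u v := by
  refine ⟨_, _, RiemannianMetric.ofForm_isBiInvariant (frobeniusForm 4) frobeniusForm_comm
      (fun _ _ h => frobeniusForm_self_pos h) fun h M N _ _ => frobeniusForm_conj h M N,
    RiemannianMetric.ofForm_isBiInvariant (frobeniusForm 4 + pfaffianForm)
      (fun M N => ?_) (fun M hM h => frobeniusForm_add_pfaffianForm_self_pos hM h) fun h M N hM hN => ?_, ?_⟩
  · rw [LinearMap.add_apply, LinearMap.add_apply, LinearMap.add_apply, LinearMap.add_apply,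
      frobeniusForm_comm, pfaffianForm_apply, pfaffianForm_apply]
    ring
  · have hdet := (Matrix.mem_specialOrthogonalGroup_iff.1 h.2).2
    simp only [LinearMap.add_apply]
    rw [frobeniusForm_conj, pfaffianForm_mul_mul _ hM hN, hdet, one_mul]
  · rintro ⟨c, hc⟩
    have key : ∀ M : Matrix (Fin 4) (Fin 4) ℝ, M.transpose = -M →
        frobeniusForm 4 M M + pfaffianForm M M = c * frobeniusForm 4 M M := fun M hM => by
      have h := hc 1 ⟨M, mem_tangentSpace_one.2 hM⟩ ⟨M, mem_tangentSpace_one.2 hM⟩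
      change frobeniusForm 4 (((1 : SO 4) : Matrix (Fin 4) (Fin 4) ℝ).transpose * M)
          (((1 : SO 4) : Matrix (Fin 4) (Fin 4) ℝ).transpose * M)
        + pfaffianForm (((1 : SO 4) : Matrix (Fin 4) (Fin 4) ℝ).transpose * M)
          (((1 : SO 4) : Matrix (Fin 4) (Fin 4) ℝ).transpose * M)
        = c * frobeniusForm 4 (((1 : SO 4) : Matrix (Fin 4) (Fin 4) ℝ).transpose * M)
          (((1 : SO 4) : Matrix (Fin 4) (Fin 4) ℝ).transpose * M) at h
      simpa only [OneMemClass.coe_one, Matrix.transpose_one, one_mul] using h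
    have hskew : ∀ i j : Fin 4, (planeGen i j).transpose = -planeGen i j := fun i j => by
      simp [planeGen]
    -- The first matrix has Pfaffian 0 and forces c = 1; the second has nonzero Pfaffian and forces
    -- c = 3/2.
    have h1 := key (planeGen 0 1) (hskew 0 1)
    have h2 := key (planeGen 0 1 + planeGen 2 3) (by
      rw [Matrix.transpose_add, hskew, hskew, neg_add])
    simp [frobeniusForm_apply, pfaffianForm_apply, planeGen, Matrix.trace, Matrix.mul_apply,
      Fin.sum_univ_four, Matrix.single_apply] at h1 h2
    linarith

end Brownian

end

theorem mainTheorem2 :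
    (∀ n : ℕ, 3 ≤ n → ∀ G : Brownian.RiemannianMetric n, G.IsBiInvariant →
      ¬ Brownian.RestrictedNegDef G.dist ∧
      ∀ x₀ : Brownian.SO n, ¬ Brownian.PosDefKernel (Brownian.brownianKernel G.dist x₀)) ∧
    (∃ G₁ G₂ : Brownian.RiemannianMetric 4, G₁.IsBiInvariant ∧ G₂.IsBiInvariant ∧
      ¬ ∃ c : ℝ, ∀ (g : Brownian.SO 4) (u v : Brownian.tangentSpace g),
        G₂.inner g u v = c * G₁.inner g u v) := by
  refine ⟨fun n hn G hG => ?_, Brownian.exists_not_proportional⟩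
  have h : ¬ Brownian.RestrictedNegDef G.dist :=
    hG.not_restrictedNegDef (i := ⟨0, by omega⟩) (j := ⟨1, by omega⟩) (k := ⟨2, by omega⟩)
      (by simp) (by simp) (by simp)
  exact ⟨h, fun x₀ hK => h hK.restrictedNegDef⟩
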